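/- Let $\alpha,\beta,\gamma,\alpha',\beta',\gamma'\in\mathbb R$ with $\beta\beta'\neq 0$ (Type I). Let the numbers $\left|{n\atop k}\right|$ be defined for $n,k\in\mathbb Z$ by $$\left|{n\atop k}\right|=(\alpha n+\beta k+\gamma)\left|{n-1\atop k}\right|+(\alpha' n+\beta' k+\gamma')\left|{n-1\atop k-1}\right|+\delta_{n0}\delta_{k0},\qquad \left|{n\atop k}\right|=0\ \text{ if } n<0 \text{ or } k<0 ,$$ and let $F(x,y)=\sum_{n,k\ge0}\left|{n\atop k}\right|x^k\frac{y^n}{n!}$ be their exponential generating function (a formal power series in $y$ with coefficients in $\mathbb R[x]$). Put $\sigma=\operatorname{sgn}(\beta\beta')$, $$r=\frac{\alpha}{\beta},\quad r'=\frac{\alpha'}{\beta'},\quad s=\frac{\alpha+\gamma}{\beta},\quad s'=-1-\frac{\alpha'+\gamma'}{\beta'},\quad \eta=s+s'+1+r'-r ,$$ define $\mathcal F$ by $F(x,y)=\mathcal F\big(\sigma\tfrac{\beta'}{\beta}x,\ \beta y\big)$, and let $\mathcal P_n(X)=n!\,[Y^n]\,\mathcal F(X,Y)$ for $n\in\mathbb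 Z_0=\{0,1,2,\dots\}$. Let $X\in\mathbb C$ with $0<|X|<1$. Fix a holomorphic branch of the logarithm in a neighbourhood of $X$, and use it for $\log X$, $\log Z$, $X^a=e^{a\log X}$ and $Z^a=e^{a\log Z}$, for $Z$ near $X$ and real $a$ (for $X\in(0,1)$ one may take the principal branch, which gives the usual real functions); powers of $1+\sigma X$ and $1+\sigma Z$ are principal. Put $$Q^0_{r,r',\sigma}(Z)=\sum_{k\in\mathbb Z_0\setminus\{r\}}\sigma^k\binom{-1-r'+r}{k}\frac{Z^{k-r}}{k-r},\qquad G^{-1}_{r,r',\sigma}(Z)=Q^0_{r,r',\sigma}(Z)+\chi_{\mathbb Z_0}(r)\,\sigma^r\binom{-1-r'+r}{r}\log Z ,$$ where $\chi_{\mathbb Z_0}$ is the characteristic function of $\mathbb Z_0$. These series converge for $Z$ near $X$, and $G^{-1}_{r,r',\sigma}(Z)\ne G^{-1}_{r,r',\sigma}(X)$ for all $Z\neq X$ near $X$. For every $n\in\mathbb Z_0$, the function of $Z$ in brackets in the next formula is holomorphic on a punctured neighbourhood of $X$, the limit exists, and $$\mathcal P_n(X)=\frac{(1+\sigma X)^{n(r-r')+s+s'}}{X^{s+rn}}\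 \lim_{Z\to X}\frac{\partial^n}{\partial Z^n}\left[\frac{Z^{s-r-1}}{(1+\sigma Z)^{\eta}}\left(\frac{Z-X}{G^{-1}_{r,r',\sigma}(Z)-G^{-1}_{r,r',\sigma}(X)}\right)^{n+1}\right].$$ If moreover $r\in\mathbb Z_0$ and $\binom{-1-r'+r}{r}\neq0$, put $$\widehat Q^0_{r,r',\sigma}(Z)=\exp\left(\frac{Q^0_{r,r',\sigma}(Z)}{\sigma^r\binom{-1-r'+r}{r}}\right).$$ Then also, with the outer logarithm principal (its argument is close to $1$ for $Z$ near $X$, and the logarithm is nonzero for $Z\ne X$ near $X$), the function of $Z$ in brackets in the next formula is holomorphic on a punctured neighbourhood of $X$, the limit exists, and $$\mathcal P_n(X)=\frac{(1+\sigma X)^{n(r-r')+s+s'}}{X^{s+rn}}\,\sigma^{(n+1)r}\binom{-1-r'+r}{r}^{-n-1}\lim_{Z\to X}\frac{\partial^n}{\partial Z^n}\left[\frac{Z^{s-r-1}(Z-X)^{n+1}}{(1+\sigma Z)^{\eta}}\left(\log\frac{Z\,\widehat Q^0_{r,r',\sigma}(Z)}{X\,\widehat Q^0_{r,r',\sigma}(X)}\right)^{-n-1}\right].$$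 -/

import Mathlib

open Filter Topology

namespace GKP

/-- The array `|n k|` of the recurrence
`|n k| = (α n + β k + γ) |n-1 k| + (α' n + β' k + γ') |n-1 k-1| + δ_{n0} δ_{k0}`,
with `|n k| = 0` when `n < 0` or `k < 0`. -/
noncomputable def num (α β γ α' β' γ' : ℝ) : ℕ → ℕ → ℝ
  | 0, 0 => 1
  | 0, _ + 1 => 0
  | n + 1, 0 => (α * (n + 1) + γ) * num α β γ α' β' γ' n 0
  | n + 1, k + 1 =>
      (α * (n + 1) + β * (k + 1) + γ) * num α β γ α' β' γ' n (k + 1)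
        + (α' * (n + 1) + β' * (k + 1) + γ') * num α β γ α' β' γ' n k

/-- `|n k| = 0` for `k > n`, so that the row generating functions are polynomials. -/
theorem num_eq_zero (α β γ α' β' γ' : ℝ) :
    ∀ n k : ℕ, n < k → num α β γ α' β' γ' n k = 0
  | 0, 0, h => absurd h (lt_irrefl 0)
  | 0, _ + 1, _ => by rw [num]
  | _ + 1, 0, h => absurd h (Nat.not_lt_zero _)
  | n + 1, k + 1, h => by
      rw [num, num_eq_zero α β γ α' β' γ' n (k + 1) (by omega),
        num_eq_zero α β γ α' β' γ' n k (by omega)]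
      ring

/-- The row generating polynomial `P_n(x) = ∑_k |n k| x^k`. -/
noncomputable def rowPoly (α β γ α' β' γ' : ℝ) (n : ℕ) : Polynomial ℝ :=
  ∑ k ∈ Finset.range (n + 1), Polynomial.monomial k (num α β γ α' β' γ' n k)

/-- The exponential generating function `F(x,y) = ∑_n P_n(x) y^n / n!`, as a formal power
series in `y` whose coefficients are polynomials in `x`. -/
noncomputable def egf (α β γ α' β' γ' : ℝ) : PowerSeries (Polynomial ℝ) :=
  PowerSeries.mk fun n => ((n.factorial : ℝ)⁻¹) • rowPoly α β γ α' β' γ' n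

/-- The substitution `H(x,y) ↦ H(a x, b y)`. -/
noncomputable def scale (a b : ℝ) (H : PowerSeries (Polynomial ℝ)) :
    PowerSeries (Polynomial ℝ) :=
  PowerSeries.rescale (Polynomial.C b)
    (PowerSeries.map (Polynomial.compRingHom (Polynomial.C a * Polynomial.X)) H)

/-- `σ = sgn(β β')`. -/
noncomputable def sgn (β β' : ℝ) : ℝ := Real.sign (β * β')

/-- The function `𝓕(X,Y)` with `F(x,y) = 𝓕(σ (β'/β) x, β y)`, that is (as `σ² = 1`),
`𝓕(X,Y) = F(σ (β/β') X, Y/β)`; see `egf_eq_scale_egfXY`. -/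
noncomputable def egfXY (α β γ α' β' γ' : ℝ) : PowerSeries (Polynomial ℝ) :=
  scale (sgn β β' * (β / β')) β⁻¹ (egf α β γ α' β' γ')

theorem egf_eq_scale_egfXY (α β γ α' β' γ' : ℝ) (h : β * β' ≠ 0) :
    egf α β γ α' β' γ' =
      scale (sgn β β' * (β' / β)) β (egfXY α β γ α' β' γ') := by
  have hβ : β ≠ 0 := left_ne_zero_of_mul h
  have hβ' : β' ≠ 0 := right_ne_zero_of_mul h
  have hs : sgn β β' * sgn β β' = 1 := by
    unfold sgn
    rcases Real.sign_apply_eq_of_ne_zero _ h with h1 | h1 <;> rw [h1] <;> norm_num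
  have hab : sgn β β' * (β / β') * (sgn β β' * (β' / β)) = 1 := by
    have : sgn β β' * (β / β') * (sgn β β' * (β' / β))
        = (sgn β β' * sgn β β') * ((β / β') * (β' / β)) := by ring
    rw [this, hs]
    field_simp
  ext1 n
  simp only [egfXY, scale, PowerSeries.coeff_rescale, PowerSeries.coeff_map,
    Polynomial.coe_compRingHom_apply]
  rw [Polynomial.mul_comp, Polynomial.comp_assoc, ← mul_assoc, Polynomial.pow_comp,
    Polynomial.C_comp, ← mul_pow, ← Polynomial.C_mul, mul_inv_cancel₀ hβ]
  simp only [Polynomial.mul_comp, Polynomial.C_comp, Polynomial.X_comp, ← mul_assoc,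
    ← Polynomial.C_mul, hab]
  simp

/-- `𝓟_n(X) = n! [Y^n] 𝓕(X,Y)`. -/
noncomputable def polyXY (α β γ α' β' γ' : ℝ) (n : ℕ) : Polynomial ℝ :=
  (n.factorial : ℝ) • PowerSeries.coeff n (egfXY α β γ α' β' γ')

/-- `Z^a`, with respect to the branch `ℓ` of the logarithm. -/
noncomputable def brPow (ℓ : ℂ → ℂ) (Z : ℂ) (a : ℝ) : ℂ := Complex.exp ((a : ℂ) * ℓ Z)

/-- The term `σ^k binom(-1-r'+r, k) Z^(k-r) / (k-r)`. -/
noncomputable def term (ℓ : ℂ → ℂ) (r r' σ : ℝ) (Z : ℂ) (k : ℕ) : ℂ :=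
  ((σ ^ k * Ring.choose (-1 - r' + r) k : ℝ) : ℂ) *
    (brPow ℓ Z ((k : ℝ) - r) / (((k : ℝ) - r : ℝ) : ℂ))

/-- `Q⁰_{r,r',σ}(Z)`, the sum of the terms over all `k ∈ {0,1,2,…} \ {r}`. -/
noncomputable def Q0 (ℓ : ℂ → ℂ) (r r' σ : ℝ) (Z : ℂ) : ℂ :=
  ∑' k : {k : ℕ // (k : ℝ) ≠ r}, term ℓ r r' σ Z k

open Classical in
/-- `χ(r) σ^r binom(-1-r'+r, r)`, with `χ` the characteristic function of `{0,1,2,…}`. -/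
noncomputable def logCoeff (r r' σ : ℝ) : ℝ :=
  if (⌊r⌋₊ : ℝ) = r then σ ^ ⌊r⌋₊ * Ring.choose (-1 - r' + r) ⌊r⌋₊ else 0

/-- `G^{-1}_{r,r',σ}(Z)`. -/
noncomputable def Ginv (ℓ : ℂ → ℂ) (r r' σ : ℝ) (Z : ℂ) : ℂ :=
  Q0 ℓ r r' σ Z + (logCoeff r r' σ : ℂ) * ℓ Z

/-- `Q̂⁰_{r,r',σ}(Z)`, used only for `r ∈ {0,1,2,…}` and `binom(-1-r'+r, r) ≠ 0`. -/
noncomputable def Q0hat (ℓ : ℂ → ℂ) (r r' σ : ℝ) (Z : ℂ) : ℂ :=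
  Complex.exp (Q0 ℓ r r' σ Z / (logCoeff r r' σ : ℂ))

/-- `(1+σX)^(n(r-r')+s+s') / X^(s+rn)`. -/
noncomputable def prefactor (ℓ : ℂ → ℂ) (r r' s s' σ : ℝ) (n : ℕ) (X : ℂ) : ℂ :=
  (1 + (σ : ℂ) * X) ^ (((n : ℝ) * (r - r') + s + s' : ℝ) : ℂ) / brPow ℓ X (s + r * n)

/-- The function of `Z` that is differentiated in the general formula. -/
noncomputable def kernelG (ℓ : ℂ → ℂ) (r r' s s' σ : ℝ) (n : ℕ) (X Z : ℂ) : ℂ :=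
  brPow ℓ Z (s - r - 1) / (1 + (σ : ℂ) * Z) ^ ((s + s' + 1 + r' - r : ℝ) : ℂ) *
    ((Z - X) / (Ginv ℓ r r' σ Z - Ginv ℓ r r' σ X)) ^ (n + 1)

/-- `log (Z Q̂⁰(Z) / (X Q̂⁰(X)))`, with the principal logarithm (for `Z` near `X` its argument
is near `1`). -/
noncomputable def logRatio (ℓ : ℂ → ℂ) (r r' σ : ℝ) (X Z : ℂ) : ℂ :=
  Complex.log ((Z * Q0hat ℓ r r' σ Z) / (X * Q0hat ℓ r r' σ X))

/-- The function of `Z` that is differentiated in the logarithmic formula. -/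
noncomputable def kernelLog (ℓ : ℂ → ℂ) (r r' s s' σ : ℝ) (n : ℕ) (X Z : ℂ) : ℂ :=
  brPow ℓ Z (s - r - 1) * (Z - X) ^ (n + 1) /
      (1 + (σ : ℂ) * Z) ^ ((s + s' + 1 + r' - r : ℝ) : ℂ) *
    logRatio ℓ r r' σ X Z ^ (-(n : ℤ) - 1)

end GKP

/-! ### Lagrange inversion for difference quotients. -/

namespace GKP

/-! Write `G` for `Ginv`. Its derivative is `g = Z^(-r-1) (1+σZ)^(-1-r'+r)`: up to `Z^(-r-1)` it is
a binomial series, whose term `k = r` integrates to the logarithm (`hasDerivAt_Ginv`). Let `D = g⁻¹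
d/dZ` be differentiation with respect to `G`, and `u = Z^s (1+σZ)^(-s-s')`. The row recurrence says
exactly that `D^k u = Z^(s+rk) (1+σZ)^(-(k(r-r')+s+s')) 𝓟_k(Z)` (`polyXY_succ`, `hasDerivAt_iterG`).

Lagrange inversion (`iteratedDeriv_mul_inv_dslope_pow`) expresses `D^n u` at `X` as the ordinary
`n`-th derivative at `X` of `g u ((Z-X)/(G(Z)-G(X)))^(n+1)`. Since `g u = Z^(s-r-1) (1+σZ)^(-η)`,
this is the bracket, and the prefactor cancels the powers in front of `𝓟_n(X)`. The logarithmic form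
follows from `Z Q̂⁰(Z) = exp(G(Z)/c)` with `c = logCoeff`. -/

theorem iteratedDeriv_sub_mul {f : ℂ → ℂ} {X : ℂ} (hf : AnalyticAt ℂ f X) (n : ℕ) :
    iteratedDeriv (n + 1) (fun Z => (Z - X) * f Z) X = (n + 1) * iteratedDeriv n f X := by
  induction n generalizing f with
  | zero =>
    have h := ((hasDerivAt_id X).sub_const X).mul hf.differentiableAt.hasDerivAt
    have h' : deriv (fun Z => (Z - X) * f Z) X = _ := h.deriv
    simp [iteratedDeriv_one, h']
  | succ n ih =>
    rw [iteratedDeriv_succ']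
    have h : deriv (fun Z => (Z - X) * f Z) =ᶠ[𝓝 X]
        (fun Z => (Z - X) * deriv f Z) + f := by
      filter_upwards [hf.eventually_analyticAt] with Z hZ
      have h := ((hasDerivAt_id Z).sub_const X).mul hZ.differentiableAt.hasDerivAt
      have h2 := h.deriv
      simp only [Pi.add_apply]
      simp only [id, one_mul] at h2
      rw [← add_comm (f Z), ← h2]
      rfl
    have ha : AnalyticAt ℂ (fun Z => (Z - X) * deriv f Z) X :=
      (analyticAt_id.sub analyticAt_const).mul hf.deriv
    rw [h.iteratedDeriv_eq, iteratedDeriv_add ha.contDiffAt hf.contDiffAt, ih hf.deriv,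
      ← iteratedDeriv_succ']
    push_cast
    ring

theorem analyticAt_dslope {f : ℂ → ℂ} {X : ℂ} (hf : AnalyticAt ℂ f X) :
    AnalyticAt ℂ (dslope f X) X :=
  let ⟨_, hp⟩ := hf
  hp.has_fpower_series_dslope_fslope.analyticAt

theorem dslope_ne_zero {f g : ℂ → ℂ} {X : ℂ} (hf : HasDerivAt f (g X) X) (h0 : g X ≠ 0) :
    dslope f X X ≠ 0 := by
  rwa [dslope_same, hf.deriv]

/-- The Lagrange inversion step: if `u k` has derivative `g * u (k + 1)` with `g = G'`, so that
`u k` is the `k`-th derivative of `u 0` with respect to `G`, then its value at `X` is a Taylor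
coefficient of `g * u 0` divided by a power of the difference quotient of `G`. -/
theorem iteratedDeriv_mul_inv_dslope_pow {G g : ℂ → ℂ} {X : ℂ} {u : ℕ → ℂ → ℂ}
    (hG : AnalyticAt ℂ G X) (hg : AnalyticAt ℂ g X) (hGg : ∀ᶠ Z in 𝓝 X, HasDerivAt G (g Z) Z)
    (h0 : g X ≠ 0) (hu : ∀ k, AnalyticAt ℂ (u k) X)
    (hd : ∀ k, ∀ᶠ Z in 𝓝 X, HasDerivAt (u k) (g Z * u (k + 1) Z) Z) (n j : ℕ) :
    iteratedDeriv n (fun Z => g Z * u j Z * (dslope G X Z)⁻¹ ^ (n + 1)) X = u (j + n) X := by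
  have hw := analyticAt_dslope hG
  have hw0 := dslope_ne_zero hGg.self_of_nhds h0
  induction n generalizing j with
  | zero =>
    simp only [iteratedDeriv_zero, zero_add, pow_one, add_zero]
    rw [dslope_same, hGg.self_of_nhds.deriv]
    field_simp
  | succ n ih =>
    have hwi (m : ℕ) : AnalyticAt ℂ (fun Z => (dslope G X Z)⁻¹ ^ m) X := (hw.inv hw0).pow m
    have hq : AnalyticAt ℂ (fun Z => u j Z * (dslope G X Z)⁻¹ ^ (n + 1)) X := (hu j).mul (hwi _)
    have hA : AnalyticAt ℂ (fun Z => g Z * u (j + 1) Z * (dslope G X Z)⁻¹ ^ (n + 1)) X :=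
      (hg.mul (hu _)).mul (hwi _)
    have hB : AnalyticAt ℂ (fun Z => g Z * u j Z * (dslope G X Z)⁻¹ ^ (n + 2)) X :=
      (hg.mul (hu _)).mul (hwi _)
    have hC : AnalyticAt ℂ (deriv fun Z => u j Z * (dslope G X Z)⁻¹ ^ (n + 1)) X := hq.deriv
    -- With `w = dslope G X`, differentiating `G(Z) = G(X) + (Z-X) w` gives `g = w + (Z-X) w'`. This
    -- eliminates `w'` from the derivative of `u_j w^(-n-1)`.
    have key : (fun Z => (Z - X) * (g Z * u (j + 1) Z * (dslope G X Z)⁻¹ ^ (n + 1))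
          - (Z - X) * deriv (fun Z => u j Z * (dslope G X Z)⁻¹ ^ (n + 1)) Z)
        =ᶠ[𝓝 X] fun Z => (n + 1 : ℂ) * ((g Z * u j Z * (dslope G X Z)⁻¹ ^ (n + 2))
          - u j Z * (dslope G X Z)⁻¹ ^ (n + 1)) := by
      filter_upwards [hw.eventually_analyticAt, hGg, hd j, hw.continuousAt.eventually_ne hw0]
        with Z hwZ hGZ huZ hneZ
      have h1 := ((hasDerivAt_id Z).sub_const X).mul hwZ.differentiableAt.hasDerivAt
      have h2 : g Z = 1 * dslope G X Z + (Z - X) * deriv (dslope G X) Z := by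
        refine hGZ.unique ?_
        have := h1.const_add (G X)
        refine this.congr_of_eventuallyEq (Eventually.of_forall fun z => ?_)
        have := sub_smul_dslope G X z
        simp only [smul_eq_mul] at this
        simp [this]
      have h3 := huZ.mul ((hwZ.differentiableAt.hasDerivAt.inv hneZ).pow (n + 1))
      have h4 : deriv (fun Z => u j Z * (dslope G X Z)⁻¹ ^ (n + 1)) Z = _ := h3.deriv
      rw [h4]
      simp only [Nat.add_sub_cancel, Pi.inv_apply, Pi.pow_apply]
      rw [show g Z * u j Z * (dslope G X Z)⁻¹ ^ (n + 2)
        = (1 * dslope G X Z + (Z - X) * deriv (dslope G X) Z) * u j Z * (dslope G X Z)⁻¹ ^ (n + 2)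
        by rw [h2]]
      push_cast
      have e : dslope G X Z * (dslope G X Z)⁻¹ = 1 := mul_inv_cancel₀ hneZ
      generalize dslope G X Z = w at *
      simp only [pow_succ, div_eq_mul_inv, mul_inv]
      linear_combination (- (n + 1) * u j Z * w⁻¹ ^ n * w⁻¹) * e
    have hZ : AnalyticAt ℂ (fun Z : ℂ => Z - X) X := analyticAt_id.sub analyticAt_const
    have hZA : AnalyticAt ℂ
        (fun Z => (Z - X) * (g Z * u (j + 1) Z * (dslope G X Z)⁻¹ ^ (n + 1))) X := hZ.mul hA
    have hZC : AnalyticAt ℂ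
        (fun Z => (Z - X) * deriv (fun Z => u j Z * (dslope G X Z)⁻¹ ^ (n + 1)) Z) X := hZ.mul hC
    -- At `X` the factor `Z - X` costs one derivative and yields `n+1`. The `(n+1)`-st derivative of
    -- `u_j w^(-n-1)` then occurs on both sides and cancels, leaving the induction hypothesis for
    -- `j+1`.
    have e1 := key.iteratedDeriv_eq (n + 1)
    rw [iteratedDeriv_fun_sub hZA.contDiffAt hZC.contDiffAt,
      iteratedDeriv_sub_mul hA, iteratedDeriv_sub_mul hC, ← iteratedDeriv_succ',
      iteratedDeriv_const_mul_field, iteratedDeriv_fun_sub hB.contDiffAt hq.contDiffAt, ih] at e1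
    have hn : (n + 1 : ℂ) ≠ 0 := by exact_mod_cast n.succ_ne_zero
    rw [← mul_sub] at e1
    have := sub_left_injective (mul_left_cancel₀ hn e1)
    rw [← this]
    congr 1
    ring

end GKP

/-! ### Differential recurrence for the row polynomials. -/

namespace GKP
open Polynomial

theorem coeff_rowPoly (α β γ α' β' γ' : ℝ) (n k : ℕ) :
    (rowPoly α β γ α' β' γ' n).coeff k = num α β γ α' β' γ' n k := by
  simp only [rowPoly, finsetSum_coeff, coeff_monomial, Finset.sum_ite_eq', Finset.mem_range]
  split_ifs with h
  · rfl
  · rw [num_eq_zero]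
    omega

theorem rowPoly_zero (α β γ α' β' γ' : ℝ) : rowPoly α β γ α' β' γ' 0 = 1 := by
  simp [rowPoly, num]

/-- The factor `k` becomes the Euler operator `x d/dx`. In the second term of the recurrence `k =
(k-1) + 1`, which adds `β'` to the constant. -/
theorem rowPoly_succ (α β γ α' β' γ' : ℝ) (n : ℕ) :
    rowPoly α β γ α' β' γ' (n + 1) =
      C (α * (n + 1) + γ) * rowPoly α β γ α' β' γ' n
        + C β * (X * derivative (rowPoly α β γ α' β' γ' n))
        + C (α' * (n + 1) + β' + γ') * (X * rowPoly α β γ α' β' γ' n)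
        + C β' * (X * (X * derivative (rowPoly α β γ α' β' γ' n))) := by
  ext k
  rcases k with _ | k
  · simp only [coeff_add, coeff_C_mul, coeff_X_mul_zero, coeff_rowPoly, num]
    ring
  · rcases k with _ | k <;>
    · simp only [coeff_add, coeff_C_mul, coeff_X_mul, coeff_X_mul_zero, coeff_derivative,
        coeff_rowPoly, num]
      push_cast
      ring

theorem polyXY_eq (α β γ α' β' γ' : ℝ) (n : ℕ) :
    polyXY α β γ α' β' γ' n =
      C (β⁻¹ ^ n) * (rowPoly α β γ α' β' γ' n).comp (C (sgn β β' * (β / β')) * X) := by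
  have h : (n.factorial : ℝ) ≠ 0 := by exact_mod_cast n.factorial_ne_zero
  simp only [polyXY, egfXY, scale, egf, PowerSeries.coeff_rescale, PowerSeries.coeff_map,
    PowerSeries.coeff_mk, coe_compRingHom_apply, smul_comp]
  rw [mul_smul_comm, smul_smul, mul_inv_cancel₀ h, one_smul, C_pow]

theorem polyXY_zero (α β γ α' β' γ' : ℝ) : polyXY α β γ α' β' γ' 0 = 1 := by
  simp [polyXY_eq, rowPoly_zero]

/-- The rescaling normalises `β, β'` to `1, σ`, by `α(n+1)+γ = β(rn+s)` and `α'(n+1)+β'+γ' =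
β'(r'n-s')`. -/
theorem polyXY_succ {α β γ α' β' γ' r r' s s' σ : ℝ} (h : β * β' ≠ 0)
    (hr : r = α / β) (hr' : r' = α' / β') (hs : s = (α + γ) / β)
    (hs' : s' = -1 - (α' + γ') / β') (hσ : σ = sgn β β') (n : ℕ) :
    polyXY α β γ α' β' γ' (n + 1) =
      (C (r * n + s) + C (σ * (r' * n - s')) * X) * polyXY α β γ α' β' γ' n
        + X * (1 + C σ * X) * derivative (polyXY α β γ α' β' γ' n) := by
  have hβ : β ≠ 0 := left_ne_zero_of_mul h
  have hβ' : β' ≠ 0 := right_ne_zero_of_mul h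
  simp only [polyXY_eq, rowPoly_succ, ← hσ]
  set P := rowPoly α β γ α' β' γ' n
  have e1 : r * n + s = β⁻¹ * (α * (n + 1) + γ) := by rw [hr, hs]; field_simp; ring
  have e2 : σ * (r' * n - s') = β⁻¹ * (α' * (n + 1) + β' + γ') * (σ * (β / β')) := by
    rw [hr', hs']; field_simp; ring
  have e3 : σ = β⁻¹ * β' * (σ * (β / β')) := by field_simp
  have e4 : (1 : ℝ) = β⁻¹ * β := by field_simp
  rw [e1, e2]
  simp only [derivative_mul, derivative_C, zero_mul, zero_add, derivative_comp, derivative_X,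
    mul_one, add_comp, mul_comp, X_comp, C_comp]
  set P' := (derivative P).comp (C (σ * (β / β')) * X)
  have e5 : (1 + C σ * X : ℝ[X]) = C β⁻¹ * C β + C β⁻¹ * C β' * C (σ * (β / β')) * X := by
    rw [← C_mul, ← C_mul, ← C_mul, ← e3, ← e4, C_1]
  rw [e5]
  generalize hc : σ * (β / β') = c
  simp only [C_mul, pow_succ]
  ring

end GKP

/-! ### Branch powers, the binomial series and the derivative of `Ginv`. -/

namespace GKP

section Branch

variable {ℓ : ℂ → ℂ} {Z : ℂ}

theorem hasDerivAt_branch (hℓ : AnalyticAt ℂ ℓ Z) (h : ∀ᶠ W in 𝓝 Z, Complex.exp (ℓ W) = W) :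
    HasDerivAt ℓ Z⁻¹ Z := by
  have h1 := hℓ.differentiableAt.hasDerivAt
  have h2 := (h1.cexp.congr_of_eventuallyEq (f₁ := id)
    (h.mono fun W hW => hW.symm)).unique (hasDerivAt_id Z)
  rw [h.self_of_nhds] at h2
  rwa [← eq_inv_of_mul_eq_one_right h2]

theorem brPow_add (a b : ℝ) : brPow ℓ Z (a + b) = brPow ℓ Z a * brPow ℓ Z b := by
  simp [brPow, add_mul, Complex.exp_add]

theorem brPow_ne_zero (a : ℝ) : brPow ℓ Z a ≠ 0 := Complex.exp_ne_zero _

theorem brPow_natCast (h : Complex.exp (ℓ Z) = Z) (k : ℕ) : brPow ℓ Z k = Z ^ k := by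
  rw [brPow, Complex.ofReal_natCast, Complex.exp_nat_mul, h]

theorem brPow_one (h : Complex.exp (ℓ Z) = Z) : brPow ℓ Z 1 = Z := by
  simpa using brPow_natCast h 1

theorem brPow_sub_one_mul (h : Complex.exp (ℓ Z) = Z) (a : ℝ) :
    brPow ℓ Z (a - 1) * Z = brPow ℓ Z a := by
  calc brPow ℓ Z (a - 1) * Z = brPow ℓ Z (a - 1) * brPow ℓ Z 1 := by rw [brPow_one h]
    _ = brPow ℓ Z a := by rw [← brPow_add, sub_add_cancel]

theorem hasDerivAt_brPow (hℓ : AnalyticAt ℂ ℓ Z) (h : ∀ᶠ W in 𝓝 Z, Complex.exp (ℓ W) = W)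
    (a : ℝ) : HasDerivAt (fun W => brPow ℓ W a) (a * brPow ℓ Z (a - 1)) Z := by
  have h1 := ((hasDerivAt_branch hℓ h).const_mul (a : ℂ)).cexp
  have hZ : Z ≠ 0 := by rw [← h.self_of_nhds]; exact Complex.exp_ne_zero _
  convert! h1 using 1
  change _ = brPow ℓ Z a * _
  rw [← brPow_sub_one_mul h.self_of_nhds a]
  field_simp

theorem analyticAt_brPow (hℓ : AnalyticAt ℂ ℓ Z) (a : ℝ) :
    AnalyticAt ℂ (fun W => brPow ℓ W a) Z :=
  (analyticAt_const.mul hℓ).cexp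

end Branch

theorem norm_mul_lt_one {σ : ℝ} (hσ : |σ| = 1) {Z : ℂ} (hZ : ‖Z‖ < 1) : ‖(σ : ℂ) * Z‖ < 1 := by
  simpa [hσ] using hZ

/-- The coefficients of `Z^r Q⁰(Z)` as a power series; division by zero drops `k = r`. -/
noncomputable def coeffQ (r r' σ : ℝ) (k : ℕ) : ℂ :=
  ((σ ^ k * Ring.choose (-1 - r' + r) k : ℝ) : ℂ) / ((k : ℂ) - r)

theorem term_eq {ℓ : ℂ → ℂ} {Z : ℂ} (h : Complex.exp (ℓ Z) = Z) (r r' σ : ℝ) (k : ℕ) :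
    term ℓ r r' σ Z k = brPow ℓ Z (-r) * (coeffQ r r' σ k * Z ^ k) := by
  rw [term, sub_eq_add_neg (k : ℝ) r, brPow_add, brPow_natCast h, coeffQ]
  push_cast
  ring

theorem summable_choose_mul_pow (a : ℝ) {ρ : ℝ} (h0 : 0 ≤ ρ) (h1 : ρ < 1) :
    Summable fun k : ℕ => |Ring.choose a k| * ρ ^ k := by
  lift ρ to NNReal using h0
  have hr : (ρ : ENNReal) < (binomialSeries ℂ (a : ℂ)).radius :=
    lt_of_lt_of_le (by exact_mod_cast h1) binomialSeries_radius_ge_one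
  refine ((binomialSeries ℂ (a : ℂ)).summable_norm_mul_pow hr).congr fun k => ?_
  rw [binomialSeries, FormalMultilinearSeries.ofScalars_norm, ← Complex.ofReal_choose,
    Complex.norm_real, Real.norm_eq_abs]

theorem hasSum_choose_mul_pow (a : ℝ) {Z : ℂ} (hZ : ‖Z‖ < 1) :
    HasSum (fun k : ℕ => ((Ring.choose a k : ℝ) : ℂ) * Z ^ k) ((1 + Z) ^ (a : ℂ)) := by
  have h := (Complex.one_add_cpow_hasFPowerSeriesOnBall_zero (a := a)).hasSum (y := Z)
    (by rw [← ENNReal.ofReal_one, Metric.eball_ofReal]; simpa using hZ)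
  simp only [binomialSeries_apply, ← Complex.ofReal_choose, List.ofFn_const, List.prod_replicate,
    smul_eq_mul, zero_add] at h
  exact h

theorem summable_coeffQ {σ : ℝ} (hσ : |σ| = 1) (r r' : ℝ) {ρ : ℝ} (h0 : 0 ≤ ρ) (h1 : ρ < 1) :
    Summable fun k : ℕ => ‖coeffQ r r' σ k‖ * ρ ^ k := by
  refine summable_of_isBigO_nat (summable_choose_mul_pow (-1 - r' + r) h0 h1) ?_
  refine Asymptotics.IsBigO.of_bound 1 ?_
  -- From this index on `|k - r| ≥ 1`, so the denominators only shrink the binomial terms.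
  filter_upwards [eventually_ge_atTop (⌈r⌉₊ + 1)] with k hk
  have hk' : 1 ≤ |(k : ℝ) - r| := by
    have h2 : ((⌈r⌉₊ + 1 : ℕ) : ℝ) ≤ k := by exact_mod_cast hk
    have h3 := Nat.le_ceil r
    push_cast at h2
    exact le_trans (by linarith) (le_abs_self _)
  have e : (k : ℂ) - r = ((k - r : ℝ) : ℂ) := by push_cast; rfl
  rw [coeffQ, e, norm_div, Complex.norm_real, Complex.norm_real, norm_mul, norm_mul, norm_mul,
    norm_pow]
  simp only [Real.norm_eq_abs, hσ, one_pow, one_mul, abs_div, abs_abs]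
  exact mul_le_mul_of_nonneg_right (div_le_self (abs_nonneg _) hk') (abs_nonneg _)

theorem summable_coeffQ_mul_pow {σ : ℝ} (hσ : |σ| = 1) (r r' : ℝ) {Z : ℂ} (hZ : ‖Z‖ < 1) :
    Summable fun k : ℕ => coeffQ r r' σ k * Z ^ k :=
  (summable_coeffQ hσ r r' (norm_nonneg Z) hZ).of_norm_bounded fun k => by simp

theorem summable_term {ℓ : ℂ → ℂ} {Z : ℂ} (h : Complex.exp (ℓ Z) = Z) {σ : ℝ} (hσ : |σ| = 1)
    (r r' : ℝ) (hZ : ‖Z‖ < 1) : Summable fun k : ℕ => term ℓ r r' σ Z k := by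
  simp_rw [term_eq h]
  exact (summable_coeffQ_mul_pow hσ r r' hZ).mul_left _

theorem Q0_eq {ℓ : ℂ → ℂ} {Z : ℂ} (h : Complex.exp (ℓ Z) = Z) (r r' σ : ℝ) :
    Q0 ℓ r r' σ Z = brPow ℓ Z (-r) * ∑' k : ℕ, coeffQ r r' σ k * Z ^ k := by
  rw [Q0, ← tsum_mul_left]
  simp_rw [term_eq h]
  refine tsum_subtype_eq_of_support_subset
    (f := fun k : ℕ => brPow ℓ Z (-r) * (coeffQ r r' σ k * Z ^ k)) (s := {k : ℕ | (k : ℝ) ≠ r}) fun k hk hkr => hk ?_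
  have : (k : ℂ) - r = 0 := by rw [← hkr]; simp
  simp [coeffQ, this]

/-- Multiplying by `k - r` restores the binomial series except for the term `k = r`, which is the
one subtracted; if `r` is not a natural number, `logCoeff` is zero. -/
theorem hasSum_sub_mul_coeffQ {σ : ℝ} (hσ : |σ| = 1) (r r' : ℝ) {Z : ℂ} (hZ : ‖Z‖ < 1) :
    HasSum (fun k : ℕ => ((k : ℂ) - r) * (coeffQ r r' σ k * Z ^ k))
      ((1 + (σ : ℂ) * Z) ^ ((-1 - r' + r : ℝ) : ℂ) - logCoeff r r' σ * Z ^ ⌊r⌋₊) := by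
  have h1 := hasSum_choose_mul_pow (-1 - r' + r) (norm_mul_lt_one hσ hZ)
  have h2 : HasSum (fun k : ℕ => if k = ⌊r⌋₊ then (logCoeff r r' σ : ℂ) * Z ^ ⌊r⌋₊ else 0)
      (logCoeff r r' σ * Z ^ ⌊r⌋₊) := hasSum_ite_eq _ _
  convert! h1.sub h2 using 2 with k
  by_cases hk : (k : ℝ) = r
  · have hk' : k = ⌊r⌋₊ := by rw [← hk, Nat.floor_natCast]
    have h0 : (k : ℂ) - r = 0 := by rw [← hk]; simp
    simp [h0, logCoeff, ← hk', hk, mul_pow]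
    ring
  · have h0 : (k : ℂ) - r ≠ 0 := by
      rw [sub_ne_zero]; exact_mod_cast hk
    have h3 : (if k = ⌊r⌋₊ then (logCoeff r r' σ : ℂ) * Z ^ ⌊r⌋₊ else 0) = 0 := by
      split_ifs with h
      · rw [logCoeff, if_neg (h ▸ hk)]
        simp
      · rfl
    rw [h3, coeffQ]
    push_cast
    field_simp
    ring

theorem hasDerivAt_tsum_coeffQ {σ : ℝ} (hσ : |σ| = 1) (r r' : ℝ) {Z : ℂ} (hZ : ‖Z‖ < 1) :
    ∃ D, HasDerivAt (fun W => ∑' k : ℕ, coeffQ r r' σ k * W ^ k) D Z ∧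
      Z * D - r * (∑' k : ℕ, coeffQ r r' σ k * Z ^ k) =
        (1 + (σ : ℂ) * Z) ^ ((-1 - r' + r : ℝ) : ℂ) - logCoeff r r' σ * Z ^ ⌊r⌋₊ := by
  -- On the disc of radius `ρ < 1` the series is dominated uniformly, so it may be differentiated
  -- termwise.
  obtain ⟨ρ, hZρ, hρ⟩ := exists_between hZ
  have h0 : 0 ≤ ρ := (norm_nonneg Z).trans hZρ.le
  have hd (k : ℕ) : DifferentiableOn ℂ (fun W => coeffQ r r' σ k * W ^ k) (Metric.ball 0 ρ) := by
    fun_prop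
  have hb (k : ℕ) (W : ℂ) (hW : W ∈ Metric.ball (0 : ℂ) ρ) :
      ‖coeffQ r r' σ k * W ^ k‖ ≤ ‖coeffQ r r' σ k‖ * ρ ^ k := by
    rw [norm_mul, norm_pow]
    have : ‖W‖ ≤ ρ := by simpa using (mem_ball_zero_iff.1 hW).le
    gcongr
  have hZb : Z ∈ Metric.ball (0 : ℂ) ρ := mem_ball_zero_iff.2 hZρ
  have hs := summable_coeffQ hσ r r' h0 hρ
  have hD := ((Complex.differentiableOn_tsum_of_summable_norm hs hd Metric.isOpen_ball
    hb).differentiableAt (Metric.isOpen_ball.mem_nhds hZb)).hasDerivAt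
  refine ⟨_, hD, ?_⟩
  have h1 := (Complex.hasSum_deriv_of_summable_norm hs hd Metric.isOpen_ball hb hZb).mul_left Z
  have h2 := (summable_coeffQ_mul_pow hσ r r' hZ).hasSum.mul_left (r : ℂ)
  refine (h1.sub h2).unique ?_
  convert! hasSum_sub_mul_coeffQ hσ r r' hZ using 2 with k
  rw [deriv_const_mul_field, deriv_pow_field]
  rcases k with _ | k
  · simp
  · rw [Nat.add_sub_cancel]
    ring

/-- With `S = Z^r Q⁰`, the derivative of `Z^(-r) S` is `Z^(-r-1) (Z S' - r S)`, a binomial series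
lacking its term `k = r`. The derivative of the logarithmic part supplies that term. -/
theorem hasDerivAt_Ginv {ℓ : ℂ → ℂ} {Z : ℂ} (hℓ : AnalyticAt ℂ ℓ Z)
    (h : ∀ᶠ W in 𝓝 Z, Complex.exp (ℓ W) = W) {σ : ℝ} (hσ : |σ| = 1) (r r' : ℝ) (hZ : ‖Z‖ < 1) :
    HasDerivAt (Ginv ℓ r r' σ)
      (brPow ℓ Z (-r - 1) * (1 + (σ : ℂ) * Z) ^ ((-1 - r' + r : ℝ) : ℂ)) Z := by
  obtain ⟨D, hD, hDe⟩ := hasDerivAt_tsum_coeffQ hσ r r' hZ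
  have h1 := ((hasDerivAt_brPow hℓ h (-r)).mul hD).add
    ((hasDerivAt_branch hℓ h).const_mul (logCoeff r r' σ : ℂ))
  have hZ0 : Z ≠ 0 := by rw [← h.self_of_nhds]; exact Complex.exp_ne_zero _
  have h3 : (logCoeff r r' σ : ℂ) * Z⁻¹
      = brPow ℓ Z (-r - 1) * (logCoeff r r' σ * Z ^ ⌊r⌋₊) := by
    by_cases hr : (⌊r⌋₊ : ℝ) = r
    · have h5 : brPow ℓ Z (-r - 1) * brPow ℓ Z r * Z = 1 := by
        rw [mul_right_comm, brPow_sub_one_mul h.self_of_nhds, ← brPow_add]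
        simp [brPow]
      rw [← brPow_natCast h.self_of_nhds, hr, mul_left_comm, eq_inv_of_mul_eq_one_left h5]
    · simp [logCoeff, hr]
  have h4 := h1.congr_of_eventuallyEq (f₁ := Ginv ℓ r r' σ) (h.mono fun W hW => by
    simp [Ginv, Q0_eq hW])
  convert! h4 using 1
  rw [h3, ← brPow_sub_one_mul h.self_of_nhds (-r)]
  push_cast at hDe ⊢
  linear_combination (-brPow ℓ Z (-r - 1)) * hDe

end GKP

/-! ### Closed form of the derivatives with respect to `Ginv`, and the two kernels. -/

namespace GKP

theorem analyticAt_iteratedDeriv {f : ℂ → ℂ} {X : ℂ} (hf : AnalyticAt ℂ f X) (n : ℕ) :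
    AnalyticAt ℂ (iteratedDeriv n f) X := by
  induction n with
  | zero => simpa using hf
  | succ n ih =>
    rw [iteratedDeriv_succ]
    exact ih.deriv

theorem eventually_eventuallyEq_nhds {f K : ℂ → ℂ} {X : ℂ} (h : f =ᶠ[𝓝[≠] X] K) :
    ∀ᶠ Z in 𝓝[≠] X, f =ᶠ[𝓝 Z] K := by
  filter_upwards [eventually_eventually_nhdsWithin.2 h, self_mem_nhdsWithin] with Z hZ hne
  rwa [isOpen_compl_singleton.nhdsWithin_eq hne] at hZ

theorem eventually_analyticAt_of_eventuallyEq {f K : ℂ → ℂ} {X : ℂ} (hK : AnalyticAt ℂ K X)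
    (h : f =ᶠ[𝓝[≠] X] K) : ∀ᶠ Z in 𝓝[≠] X, AnalyticAt ℂ f Z := by
  filter_upwards [eventually_eventuallyEq_nhds h,
    hK.eventually_analyticAt.filter_mono nhdsWithin_le_nhds] with Z hZ hKZ
  exact hKZ.congr hZ.symm

/-- The kernels are `0/0` at `X` itself, so the limit is computed from an analytic extension `K`;
equality on a punctured neighbourhood, being open, passes to derivatives there. -/
theorem tendsto_iteratedDeriv_of_eventuallyEq {f K : ℂ → ℂ} {X : ℂ} (hK : AnalyticAt ℂ K X)
    (h : f =ᶠ[𝓝[≠] X] K) (n : ℕ) :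
    Tendsto (fun Z => iteratedDeriv n f Z) (𝓝[≠] X) (𝓝 (iteratedDeriv n K X)) := by
  refine Tendsto.congr' ?_
    ((analyticAt_iteratedDeriv hK n).continuousAt.tendsto.mono_left nhdsWithin_le_nhds)
  filter_upwards [eventually_eventuallyEq_nhds h] with Z hZ
  exact (hZ.iteratedDeriv_eq n).symm

theorem one_add_mem_slitPlane {σ : ℝ} (hσ : |σ| = 1) {Z : ℂ} (hZ : ‖Z‖ < 1) :
    1 + (σ : ℂ) * Z ∈ Complex.slitPlane :=
  Complex.mem_slitPlane_of_norm_lt_one (norm_mul_lt_one hσ hZ)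

theorem analyticAt_one_add_cpow {σ : ℝ} (hσ : |σ| = 1) {Z : ℂ} (hZ : ‖Z‖ < 1) (c : ℂ) :
    AnalyticAt ℂ (fun W => (1 + (σ : ℂ) * W) ^ c) Z :=
  (analyticAt_const.add (analyticAt_const.mul analyticAt_id)).cpow analyticAt_const
    (one_add_mem_slitPlane hσ hZ)

/-- The derivative of `Ginv`. -/
noncomputable def derivGinv (ℓ : ℂ → ℂ) (r r' σ : ℝ) (Z : ℂ) : ℂ :=
  brPow ℓ Z (-r - 1) * (1 + (σ : ℂ) * Z) ^ ((-1 - r' + r : ℝ) : ℂ)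

/-- The `k`-th derivative of `Z^s (1+σZ)^(-s-s')` with respect to `Ginv`, in closed form. -/
noncomputable def iterG (ℓ : ℂ → ℂ) (r r' s s' σ : ℝ) (P : ℕ → Polynomial ℝ) (k : ℕ) (Z : ℂ) : ℂ :=
  brPow ℓ Z (s + r * k) * (1 + (σ : ℂ) * Z) ^ ((-(k * (r - r') + s + s') : ℝ) : ℂ) *
    Polynomial.aeval Z (P k)

section

variable {ℓ : ℂ → ℂ} {Z X : ℂ} {r r' s s' σ : ℝ} {P : ℕ → Polynomial ℝ}

theorem analyticAt_derivGinv (hℓ : AnalyticAt ℂ ℓ Z) (hσ : |σ| = 1) (hZ : ‖Z‖ < 1) :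
    AnalyticAt ℂ (derivGinv ℓ r r' σ) Z :=
  (analyticAt_brPow hℓ _).mul (analyticAt_one_add_cpow hσ hZ _)

theorem derivGinv_ne_zero (hσ : |σ| = 1) (hZ : ‖Z‖ < 1) : derivGinv ℓ r r' σ Z ≠ 0 :=
  mul_ne_zero (brPow_ne_zero _) (by
    rw [Complex.cpow_ne_zero_iff]
    exact Or.inl (Complex.slitPlane_ne_zero (one_add_mem_slitPlane hσ hZ)))

theorem analyticAt_iterG (hℓ : AnalyticAt ℂ ℓ Z) (hσ : |σ| = 1) (hZ : ‖Z‖ < 1) (k : ℕ) :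
    AnalyticAt ℂ (iterG ℓ r r' s s' σ P k) Z :=
  ((analyticAt_brPow hℓ _).mul (analyticAt_one_add_cpow hσ hZ _)).mul
    (analyticAt_id.aeval_polynomial (P k))

/-- After one power of `Z` and one of `1+σZ` are factored out, the product rule leaves the right
side of the recurrence `hP`: with `a = s+rk` and `e = -(k(r-r')+s+s')`, the factor `a(1+σZ) + eσZ`
equals `rk + s + σ(r'k-s')Z`. -/
theorem hasDerivAt_iterG (hℓ : AnalyticAt ℂ ℓ Z) (h : ∀ᶠ W in 𝓝 Z, Complex.exp (ℓ W) = W)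
    (hσ : |σ| = 1) (hZ : ‖Z‖ < 1)
    (hP : ∀ n : ℕ, P (n + 1) =
      (.C (r * n + s) + .C (σ * (r' * n - s')) * .X) * P n
        + .X * (1 + .C σ * .X) * Polynomial.derivative (P n)) (k : ℕ) :
    HasDerivAt (iterG ℓ r r' s s' σ P k) (derivGinv ℓ r r' σ Z * iterG ℓ r r' s s' σ P (k + 1) Z)
      Z := by
  have hm := one_add_mem_slitPlane hσ hZ
  have h1 := hasDerivAt_brPow hℓ h (s + r * k)
  have h2 := (((hasDerivAt_id Z).const_mul (σ : ℂ)).const_add 1).cpow_const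
    (c := ((-(k * (r - r') + s + s') : ℝ) : ℂ)) hm
  have h3 := (P k).hasDerivAt_aeval Z
  convert! (h1.mul h2).mul h3 using 1
  simp only [derivGinv, iterG, hP, id, Pi.mul_apply]
  rw [← brPow_sub_one_mul h.self_of_nhds (s + r * k)]
  have e1 : brPow ℓ Z (s + r * (k + 1 : ℕ)) * brPow ℓ Z (-r - 1) = brPow ℓ Z (s + r * k - 1) := by
    rw [← brPow_add]
    congr 1
    push_cast
    ring
  have hne := Complex.slitPlane_ne_zero hm
  have e2 : (1 + (σ : ℂ) * Z) ^ ((-((k + 1 : ℕ) * (r - r') + s + s') : ℝ) : ℂ) *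
      (1 + (σ : ℂ) * Z) ^ ((-1 - r' + r : ℝ) : ℂ) =
      (1 + (σ : ℂ) * Z) ^ (((-(k * (r - r') + s + s') : ℝ) : ℂ) - 1) := by
    rw [← Complex.cpow_add _ _ hne]
    congr 1
    push_cast
    ring
  have e3 : (1 + (σ : ℂ) * Z) ^ ((-(k * (r - r') + s + s') : ℝ) : ℂ) =
      (1 + (σ : ℂ) * Z) ^ (((-(k * (r - r') + s + s') : ℝ) : ℂ) - 1) * (1 + (σ : ℂ) * Z) := by
    rw [Complex.cpow_sub _ _ hne, Complex.cpow_one, div_mul_cancel₀ _ hne]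
  have e0 (a b c d p : ℂ) : a * b * (c * d * p) = (c * a) * (d * b) * p := by ring
  rw [e3, e0, e1, e2]
  generalize (1 + (σ : ℂ) * Z) ^ (((-(k * (r - r') + s + s') : ℝ) : ℂ) - 1) = B
  generalize brPow ℓ Z (s + r * k - 1) = A
  simp only [map_add, map_mul, Polynomial.aeval_C, Polynomial.aeval_X, map_one,
    Complex.coe_algebraMap]
  push_cast
  ring

theorem eventually_hasDerivAt_Ginv (hℓ : AnalyticAt ℂ ℓ X)
    (h : ∀ᶠ W in 𝓝 X, Complex.exp (ℓ W) = W) (hσ : |σ| = 1) (hX : ‖X‖ < 1) :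
    ∀ᶠ Z in 𝓝 X, HasDerivAt (Ginv ℓ r r' σ) (derivGinv ℓ r r' σ Z) Z := by
  filter_upwards [hℓ.eventually_analyticAt, h.eventually_nhds,
    continuous_norm.continuousAt.eventually_lt continuousAt_const hX] with Z h1 h2 h3
  exact hasDerivAt_Ginv h1 h2 hσ r r' h3

theorem analyticAt_Ginv (hℓ : AnalyticAt ℂ ℓ X)
    (h : ∀ᶠ W in 𝓝 X, Complex.exp (ℓ W) = W) (hσ : |σ| = 1) (hX : ‖X‖ < 1) :
    AnalyticAt ℂ (Ginv ℓ r r' σ) X :=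
  Complex.analyticAt_iff_eventually_differentiableAt.2
    ((eventually_hasDerivAt_Ginv hℓ h hσ hX).mono fun _ hZ => hZ.differentiableAt)

/-- The analytic extension of `kernelG` to `X`. -/
noncomputable def kernelExt (ℓ : ℂ → ℂ) (r r' s s' σ : ℝ) (P : ℕ → Polynomial ℝ) (n : ℕ)
    (X Z : ℂ) : ℂ :=
  derivGinv ℓ r r' σ Z * iterG ℓ r r' s s' σ P 0 Z * (dslope (Ginv ℓ r r' σ) X Z)⁻¹ ^ (n + 1)

theorem dslope_Ginv_ne_zero (hℓ : AnalyticAt ℂ ℓ X)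
    (h : ∀ᶠ W in 𝓝 X, Complex.exp (ℓ W) = W) (hσ : |σ| = 1) (hX : ‖X‖ < 1) :
    dslope (Ginv ℓ r r' σ) X X ≠ 0 :=
  dslope_ne_zero (eventually_hasDerivAt_Ginv hℓ h hσ hX).self_of_nhds (derivGinv_ne_zero hσ hX)

theorem eventually_Ginv_ne (hℓ : AnalyticAt ℂ ℓ X)
    (h : ∀ᶠ W in 𝓝 X, Complex.exp (ℓ W) = W) (hσ : |σ| = 1) (hX : ‖X‖ < 1) :
    ∀ᶠ Z in 𝓝[≠] X, Ginv ℓ r r' σ Z ≠ Ginv ℓ r r' σ X := by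
  have hG := analyticAt_Ginv (r := r) (r' := r') hℓ h hσ hX
  filter_upwards [((analyticAt_dslope hG).continuousAt.eventually_ne
    (dslope_Ginv_ne_zero hℓ h hσ hX)).filter_mono nhdsWithin_le_nhds, self_mem_nhdsWithin]
    with Z hZ hne
  rw [← sub_ne_zero, ← sub_smul_dslope]
  exact mul_ne_zero (sub_ne_zero.2 hne) hZ

theorem analyticAt_kernelExt (hℓ : AnalyticAt ℂ ℓ X)
    (h : ∀ᶠ W in 𝓝 X, Complex.exp (ℓ W) = W) (hσ : |σ| = 1) (hX : ‖X‖ < 1) (n : ℕ) :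
    AnalyticAt ℂ (kernelExt ℓ r r' s s' σ P n X) X :=
  ((analyticAt_derivGinv hℓ hσ hX).mul (analyticAt_iterG hℓ hσ hX 0)).mul
    (((analyticAt_dslope (analyticAt_Ginv hℓ h hσ hX)).inv
      (dslope_Ginv_ne_zero hℓ h hσ hX)).pow (n + 1))

theorem kernelG_eventuallyEq (hσ : |σ| = 1) (hX : ‖X‖ < 1) (hP0 : P 0 = 1) (n : ℕ) :
    kernelG ℓ r r' s s' σ n X =ᶠ[𝓝[≠] X] kernelExt ℓ r r' s s' σ P n X := by
  filter_upwards [(continuous_norm.continuousAt.eventually_lt continuousAt_const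
    hX).filter_mono nhdsWithin_le_nhds, self_mem_nhdsWithin] with Z hZ hne
  have hne1 := Complex.slitPlane_ne_zero (one_add_mem_slitPlane hσ hZ)
  have e1 : brPow ℓ Z (s - r - 1) = brPow ℓ Z (-r - 1) * brPow ℓ Z (s + r * (0 : ℕ)) := by
    rw [← brPow_add]
    congr 1
    push_cast
    ring
  have e2 : ((1 + (σ : ℂ) * Z) ^ ((s + s' + 1 + r' - r : ℝ) : ℂ))⁻¹ =
      (1 + (σ : ℂ) * Z) ^ ((-1 - r' + r : ℝ) : ℂ) *
      (1 + (σ : ℂ) * Z) ^ ((-((0 : ℕ) * (r - r') + s + s') : ℝ) : ℂ) := by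
    rw [← Complex.cpow_add _ _ hne1, ← Complex.cpow_neg]
    congr 1
    push_cast
    ring
  rw [kernelG, kernelExt, derivGinv, iterG, hP0, map_one, mul_one, div_eq_mul_inv _ (_ ^ _), e1, e2,
    dslope_of_ne _ hne, slope_def_field, inv_div]
  ring

theorem iteratedDeriv_kernelExt (hℓ : AnalyticAt ℂ ℓ X)
    (h : ∀ᶠ W in 𝓝 X, Complex.exp (ℓ W) = W) (hσ : |σ| = 1) (hX : ‖X‖ < 1)
    (hP : ∀ n : ℕ, P (n + 1) =
      (.C (r * n + s) + .C (σ * (r' * n - s')) * .X) * P n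
        + .X * (1 + .C σ * .X) * Polynomial.derivative (P n)) (n : ℕ) :
    prefactor ℓ r r' s s' σ n X * iteratedDeriv n (kernelExt ℓ r r' s s' σ P n X) X =
      Polynomial.aeval X (P n) := by
  have key := iteratedDeriv_mul_inv_dslope_pow (u := iterG ℓ r r' s s' σ P)
    (analyticAt_Ginv (r := r) (r' := r') hℓ h hσ hX) (analyticAt_derivGinv hℓ hσ hX)
    (eventually_hasDerivAt_Ginv hℓ h hσ hX) (derivGinv_ne_zero hσ hX)
    (fun k => analyticAt_iterG hℓ hσ hX k) (fun k => by
      filter_upwards [hℓ.eventually_analyticAt, h.eventually_nhds,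
        continuous_norm.continuousAt.eventually_lt continuousAt_const hX] with Z h1 h2 h3
      exact hasDerivAt_iterG h1 h2 hσ h3 hP k) n 0
  rw [zero_add] at key
  have hne : (1 + (σ : ℂ) * X) ^ ((n * (r - r') + s + s' : ℝ) : ℂ) ≠ 0 := by
    rw [Complex.cpow_ne_zero_iff]
    exact Or.inl (Complex.slitPlane_ne_zero (one_add_mem_slitPlane hσ hX))
  have hb := brPow_ne_zero (ℓ := ℓ) (Z := X) (s + r * n)
  change prefactor ℓ r r' s s' σ n X * iteratedDeriv n (fun Z => _) X = _
  simp only [kernelExt]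
  rw [key, prefactor, iterG, Complex.ofReal_neg, Complex.cpow_neg]
  generalize brPow ℓ X (s + r * n) = b at *
  field_simp

theorem logRatio_eventuallyEq (hℓ : AnalyticAt ℂ ℓ X)
    (h : ∀ᶠ W in 𝓝 X, Complex.exp (ℓ W) = W) (hσ : |σ| = 1) (hX : ‖X‖ < 1)
    (hc : logCoeff r r' σ ≠ 0) :
    logRatio ℓ r r' σ X =ᶠ[𝓝 X]
      fun Z => (Ginv ℓ r r' σ Z - Ginv ℓ r r' σ X) / logCoeff r r' σ := by
  have hc' : (logCoeff r r' σ : ℂ) ≠ 0 := by exact_mod_cast hc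
  have hq {Z : ℂ} (hZ : Complex.exp (ℓ Z) = Z) :
      Z * Q0hat ℓ r r' σ Z = Complex.exp (Ginv ℓ r r' σ Z / logCoeff r r' σ) := by
    nth_rw 1 [← hZ]
    rw [Q0hat, ← Complex.exp_add, Ginv, add_div, mul_div_cancel_left₀ _ hc', add_comm]
  -- The exponent vanishes at `X`, so near `X` its imaginary part stays in `(-π, π)` and the
  -- principal logarithm undoes the exponential.
  have hcont : ContinuousAt
      (fun Z => ((Ginv ℓ r r' σ Z - Ginv ℓ r r' σ X) / logCoeff r r' σ).im) X :=
    Complex.continuous_im.continuousAt.comp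
      (((analyticAt_Ginv hℓ h hσ hX).continuousAt.sub continuousAt_const).div_const _)
  have h1 := hcont.eventually (Ioo_mem_nhds (a := -Real.pi) (b := Real.pi)
    (by simp [Real.pi_pos]) (by simp [Real.pi_pos]))
  filter_upwards [h, h1] with Z hZ hI
  rw [logRatio, hq hZ, hq h.self_of_nhds, ← Complex.exp_sub, ← sub_div,
    Complex.log_exp hI.1 hI.2.le]

theorem kernelLog_eventuallyEq (hℓ : AnalyticAt ℂ ℓ X)
    (h : ∀ᶠ W in 𝓝 X, Complex.exp (ℓ W) = W) (hσ : |σ| = 1) (hX : ‖X‖ < 1)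
    (hc : logCoeff r r' σ ≠ 0) (n : ℕ) :
    kernelLog ℓ r r' s s' σ n X =ᶠ[𝓝 X]
      fun Z => (logCoeff r r' σ : ℂ) ^ (n + 1) * kernelG ℓ r r' s s' σ n X Z := by
  filter_upwards [logRatio_eventuallyEq hℓ h hσ hX hc] with Z hZ
  rw [kernelLog, hZ, kernelG, show -(n : ℤ) - 1 = -((n + 1 : ℕ) : ℤ) by push_cast; ring, zpow_neg,
    zpow_natCast, ← inv_pow, inv_div, div_pow, div_pow]
  ring

end

end GKP

/-! ### The two limit formulas. -/

theorem theorem4p1 (α β γ α' β' γ' r r' s s' σ : ℝ)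
    (hTypeI : β * β' ≠ 0)
    (hr : r = α / β) (hr' : r' = α' / β')
    (hs : s = (α + γ) / β) (hs' : s' = -1 - (α' + γ') / β')
    (hσ : σ = GKP.sgn β β')
    (n : ℕ) (X : ℂ) (hX0 : 0 < ‖X‖) (hX1 : ‖X‖ < 1)
    (ℓ : ℂ → ℂ) (hℓ : AnalyticAt ℂ ℓ X) (hexp : ∀ᶠ Z in 𝓝 X, Complex.exp (ℓ Z) = Z) :
    -- near `X` the series converges, and the bracketed function is defined and holomorphic
    (∀ᶠ Z in 𝓝 X,
        Summable fun k : {k : ℕ // (k : ℝ) ≠ r} => GKP.term ℓ r r' σ Z k) ∧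
    (∀ᶠ Z in 𝓝[≠] X, GKP.Ginv ℓ r r' σ Z ≠ GKP.Ginv ℓ r r' σ X ∧
        AnalyticAt ℂ (GKP.kernelG ℓ r r' s s' σ n X) Z) ∧
    -- the general formula
    (∃ L : ℂ,
        Tendsto (fun Z => iteratedDeriv n (GKP.kernelG ℓ r r' s s' σ n X) Z) (𝓝[≠] X) (𝓝 L) ∧
        Polynomial.aeval X (GKP.polyXY α β γ α' β' γ' n) =
          GKP.prefactor ℓ r r' s s' σ n X * L) ∧
    -- the logarithmic formula
    (∀ m : ℕ, r = m → Ring.choose (-1 - r' + r) m ≠ 0 →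
      (∀ᶠ Z in 𝓝[≠] X, GKP.logRatio ℓ r r' σ X Z ≠ 0 ∧
        AnalyticAt ℂ (GKP.kernelLog ℓ r r' s s' σ n X) Z) ∧
      ∃ L : ℂ,
        Tendsto (fun Z => iteratedDeriv n (GKP.kernelLog ℓ r r' s s' σ n X) Z)
          (𝓝[≠] X) (𝓝 L) ∧
        Polynomial.aeval X (GKP.polyXY α β γ α' β' γ' n) =
          GKP.prefactor ℓ r r' s s' σ n X * (σ : ℂ) ^ ((n + 1) * m) *
            ((Ring.choose (-1 - r' + r) m : ℝ) : ℂ) ^ (-(n : ℤ) - 1) * L) := by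
  have hσ1 : |σ| = 1 := by
    rw [hσ, GKP.sgn]
    rcases Real.sign_apply_eq_of_ne_zero _ hTypeI with h | h <;> rw [h] <;> simp
  have hσ2 : (σ : ℂ) * σ = 1 := by
    rw [← Complex.ofReal_mul, ← abs_mul_abs_self, hσ1]
    simp
  have hP := GKP.polyXY_succ hTypeI hr hr' hs hs' hσ
  have hP0 := GKP.polyXY_zero α β γ α' β' γ'
  have hlt := continuous_norm.continuousAt.eventually_lt continuousAt_const hX1
  have hK : AnalyticAt ℂ (GKP.kernelExt ℓ r r' s s' σ (GKP.polyXY α β γ α' β' γ') n X) X :=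
    GKP.analyticAt_kernelExt hℓ hexp hσ1 hX1 n
  have hG := GKP.kernelG_eventuallyEq (ℓ := ℓ) (r := r) (r' := r') (s := s) (s' := s') hσ1 hX1 hP0 n
  have hF := GKP.iteratedDeriv_kernelExt hℓ hexp hσ1 hX1 hP n
  have hne := GKP.eventually_Ginv_ne (r := r) (r' := r') hℓ hexp hσ1 hX1
  refine ⟨?_, hne.and (GKP.eventually_analyticAt_of_eventuallyEq hK hG),
    ⟨_, GKP.tendsto_iteratedDeriv_of_eventuallyEq hK hG n, hF.symm⟩, fun m hm hch => ?_⟩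
  · filter_upwards [hexp, hlt] with Z hZ hZ1
    exact (GKP.summable_term hZ hσ1 r r' hZ1).subtype {k : ℕ | (k : ℝ) ≠ r}
  · have hc : GKP.logCoeff r r' σ = σ ^ m * Ring.choose (-1 - r' + r) m := by
      rw [GKP.logCoeff, hm, Nat.floor_natCast, if_pos rfl]
    have hσ0 : σ ≠ 0 := by rintro rfl; simp at hσ1
    have hc0 : GKP.logCoeff r r' σ ≠ 0 := by
      rw [hc]
      exact mul_ne_zero (pow_ne_zero _ hσ0) hch
    have hc0' : (GKP.logCoeff r r' σ : ℂ) ≠ 0 := by exact_mod_cast hc0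
    have hL := (GKP.kernelLog_eventuallyEq (s := s) (s' := s') hℓ hexp hσ1 hX1 hc0 n).filter_mono
      (nhdsWithin_le_nhds (s := {X}ᶜ))
    have hL' := hL.trans (hG.fun_comp fun w => (GKP.logCoeff r r' σ : ℂ) ^ (n + 1) * w)
    have hKc := (analyticAt_const (v := (GKP.logCoeff r r' σ : ℂ) ^ (n + 1))).mul hK
    refine ⟨Eventually.and ?_ (GKP.eventually_analyticAt_of_eventuallyEq hKc hL'),
      ⟨_, GKP.tendsto_iteratedDeriv_of_eventuallyEq hKc hL' n, ?_⟩⟩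
    · filter_upwards [hne, (GKP.logRatio_eventuallyEq hℓ hexp hσ1 hX1 hc0).filter_mono
        nhdsWithin_le_nhds] with Z hZ hZl
      rw [hZl]
      exact div_ne_zero (sub_ne_zero.2 hZ) hc0'
    · have hch' : ((Ring.choose (-1 - r' + r) m : ℝ) : ℂ) ≠ 0 := by exact_mod_cast hch
      change _ = _ * iteratedDeriv n (fun Z => (GKP.logCoeff r r' σ : ℂ) ^ (n + 1) * _) X
      rw [iteratedDeriv_const_mul_field, ← hF, hc,
        show -(n : ℤ) - 1 = -((n + 1 : ℕ) : ℤ) by push_cast; ring, zpow_neg, zpow_natCast]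
      -- The logarithmic kernel carries an extra `c^(n+1)`. As `σ² = 1`, the power of `σ` in it is
      -- its own inverse, hence the positive exponent in the formula.
      have e : (σ : ℂ) ^ ((n + 1) * m) * σ ^ ((n + 1) * m) = 1 := by rw [← mul_pow, hσ2, one_pow]
      rw [Complex.ofReal_mul, Complex.ofReal_pow, mul_pow, ← pow_mul, mul_comm m (n + 1)]
      generalize (σ : ℂ) ^ ((n + 1) * m) = S at e ⊢
      have e' := mul_inv_cancel₀ (pow_ne_zero (n + 1) hch')
      generalize ((Ring.choose (-1 - r' + r) m : ℝ) : ℂ) ^ (n + 1) = D at e' ⊢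
      generalize GKP.prefactor ℓ r r' s s' σ n X = A
      generalize iteratedDeriv n (_ : ℂ → ℂ) X = B
      linear_combination (-A * B * S * S) * e' - A * B * e
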